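/- In a General Lotto game on finitely many battlefields, players $A$ and $B$ have budgets $X_A, X_B$ and valuations $v_{A,b}, v_{B,b}$. Simultaneously and independently, each player $i$ chooses a probability distribution over nonnegative allocation vectors whose expected total is at most $X_i$. The player with the larger allocation on $b$ wins $b$ (ties are split evenly) and gets its own valuation of $b$; payoffs are expected total values won, and equilibrium means Nash equilibrium. Let $X_A, X_B > 0$ and $\alpha \in (0,\tfrac12]$, and let $\mathrm{GGL}(X_A,X_B,\alpha)$ be the game with two battlefields and $v_{A,1}=\alpha$, $v_{A,2}=1-\alpha$, $v_{B,1}=1-\alpha$, $v_{B,2}=\alpha$. Before play, $B$ may pre-commit an amount $p\in[0,X_B]$ to battlefield 1. $A$ then either matches (possible only if $p\le X_A$), paying $p$ and winning battlefield 1, or withdraws, in which case $B$ wins battlefield 1. Then the Lotto game on battlefield 2 is played in equilibrium, with budgets $X_A-p, X_B-p$ after matching and $X_A, X_B-p$ after withdrawing. $A$ chooses the response that gives it the higher total payoff, and withdraws if indifferent. Suppose that the set of equilibrium payoffs of $B$ in $\mathrm{GGL}(X_A,X_B,\alpha)$ consists of exactly three values $\pi_1 > \pi_2 > \pi_3$,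 and that either $$\sqrt{\tfrac{8\alpha}{1-\alpha}}-\tfrac{2\alpha}{1-\alpha}\le \tfrac{X_B}{X_A}\le 1 \qquad\text{or}\qquad \tfrac{X_B}{X_A}>1 .$$ Then $\pi_2 < 1-\alpha$, and there is a pre-commitment $p\in[0,X_B]$ to battlefield 1 to which $A$ responds by withdrawing and after which the payoff of $B$ is always greater than $1-\alpha$, hence greater than the second-highest equilibrium payoff $\pi_2$ of $\mathrm{GGL}(X_A,X_B,\alpha)$. -/

import Mathlib

open MeasureTheory
open scoped NNReal ENNReal

/-- The data of a (generalized) General Lotto game on a set `ι` of battlefields: the budgets of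
the two players and their valuations of the battlefields. -/
structure LottoGame (ι : Type*) where
  /-- budget of player A -/
  XA : ℝ
  /-- budget of player B -/
  XB : ℝ
  /-- valuations of player A -/
  vA : ι → ℝ
  /-- valuations of player B -/
  vB : ι → ℝ

/-- An admissible strategy with budget `X`: a distribution of nonnegative allocation vectors whose
expected total amount is at most `X`. -/
def IsLottoStrategy {ι : Type*} [Fintype ι] (X : ℝ) (F : Measure (ι → ℝ≥0)) : Prop :=
  IsProbabilityMeasure F ∧ ∫⁻ x, ∑ b, (x b : ℝ≥0∞) ∂F ≤ ENNReal.ofReal X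

/-- The share of a battlefield won by an allocation `x` against the opponent's `y`: the larger
allocation wins, ties are split evenly. -/
noncomputable def winShare (x y : ℝ≥0) : ℝ :=
  if y < x then 1 else if x = y then 1 / 2 else 0

/-- Expected payoff of a player with valuations `v` and strategy `F` when the opponent,
independently, uses `F'`. -/
noncomputable def lottoPayoff {ι : Type*} [Fintype ι] (v : ι → ℝ)
    (F F' : Measure (ι → ℝ≥0)) : ℝ :=
  ∫ z, ∑ b, v b * winShare (z.1 b) (z.2 b) ∂(F.prod F')

/-- Nash equilibrium of a Lotto game in simultaneous play. -/
def LottoGame.IsEquilibrium {ι : Type*} [Fintype ι] (G : LottoGame ι)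
    (FA FB : Measure (ι → ℝ≥0)) : Prop :=
  IsLottoStrategy G.XA FA ∧ IsLottoStrategy G.XB FB ∧
  (∀ F, IsLottoStrategy G.XA F → lottoPayoff G.vA F FB ≤ lottoPayoff G.vA FA FB) ∧
  (∀ F, IsLottoStrategy G.XB F → lottoPayoff G.vB F FA ≤ lottoPayoff G.vB FB FA)

/-- The set of equilibrium payoff pairs (payoff of A, payoff of B). -/
def LottoGame.equilibriumPayoffs {ι : Type*} [Fintype ι] (G : LottoGame ι) : Set (ℝ × ℝ) :=
  {u | ∃ FA FB, G.IsEquilibrium FA FB ∧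
    u = (lottoPayoff G.vA FA FB, lottoPayoff G.vB FB FA)}

/-- The set of payoffs that player B has in equilibria. -/
def LottoGame.equilibriumPayoffsB {ι : Type*} [Fintype ι] (G : LottoGame ι) : Set ℝ :=
  Prod.snd '' G.equilibriumPayoffs

/-- The Lotto game on the battlefields other than `b` that is played after B has pre-committed `p`
to `b` and A has matched with `p` of its own resources. -/
def LottoGame.afterMatch {ι : Type*} (G : LottoGame ι) (b : ι) (p : ℝ) :
    LottoGame {c : ι // c ≠ b} where
  XA := G.XA - p
  XB := G.XB - p
  vA := fun c => G.vA c
  vB := fun c => G.vB c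

/-- The Lotto game on the battlefields other than `b` that is played after B has pre-committed `p`
to `b` and A has withdrawn from `b`. -/
def LottoGame.afterWithdraw {ι : Type*} (G : LottoGame ι) (b : ι) (p : ℝ) :
    LottoGame {c : ι // c ≠ b} where
  XA := G.XA
  XB := G.XB - p
  vA := fun c => G.vA c
  vB := fun c => G.vB c

/-- The two responses of player A to a pre-commitment on one battlefield. -/
inductive PrecommitResponse where
  | secure
  | withdraw

/-- `G.IsPrecommitOutcome b p r uA uB`: when B pre-commits `p` to battlefield `b`, it is optimal for
A to respond with `r`, and the total payoffs are then `uA` and `uB`. The remaining battlefields are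
contested in equilibrium after either response. Matching wins `b` for A and is possible only if
`p ≤ XA`; withdrawing leaves `b` to B. If A is indifferent, it withdraws. -/
def LottoGame.IsPrecommitOutcome {ι : Type*} [Fintype ι] [DecidableEq ι] (G : LottoGame ι)
    (b : ι) (p : ℝ) : PrecommitResponse → ℝ → ℝ → Prop
  | .secure, uA, uB =>
      p ≤ G.XA ∧
      ∃ m ∈ (G.afterMatch b p).equilibriumPayoffs,
        ∃ w ∈ (G.afterWithdraw b p).equilibriumPayoffs,
          w.1 < G.vA b + m.1 ∧ uA = G.vA b + m.1 ∧ uB = m.2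
  | .withdraw, uA, uB =>
      ∃ w ∈ (G.afterWithdraw b p).equilibriumPayoffs,
        (p ≤ G.XA → ∃ m ∈ (G.afterMatch b p).equilibriumPayoffs, G.vA b + m.1 ≤ w.1) ∧
        uA = w.1 ∧ uB = G.vB b + w.2

/-- The two-battlefield game in which A values the battlefields `α`, `1 - α` and B values them
`1 - α`, `α`. Index `0` is the first battlefield. -/
def GGL (XA XB α : ℝ) : LottoGame (Fin 2) where
  XA := XA
  XB := XB
  vA := ![α, 1 - α]
  vB := ![1 - α, α]

/-! In equilibrium each player maximizes a linear functional under one expected-budget constraint. A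
Lagrange multiplier therefore prices the resource, and the problem separates into one all-pay
contest per battlefield (`LottoGame.IsEquilibrium.exists_allPay`). Expected efforts and win
probabilities in such a contest are determined by the two prizes (`isAllPayOutcome`). An equilibrium
of `GGL` is thus described by one unknown, the ratio `σ` of the multipliers: `GGLBranch` gives both
the budget ratio and the payoff of B in terms of `σ`.

With `β = α / (1 - α)`, the budget ratio is strictly increasing in `σ` if `1/2 ≤ β`, and in any case
from a `σ` with `1 ≤ β * σ ^ 2` onwards (`GGLBranch.ratio_lt`). Several payoffs therefore force `β <
1/2`. A payoff of at least `1 - α` forces `1 ≤ β * σ ^ 2` (`GGLBranch.one_le_mul_sq`), so at most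
one equilibrium payoff is that large, and `π₂ < 1 - α`.

Once A withdraws, B holds `1 - α` from battlefield 1 and, as long as `p < XB`, wins a positive share
of battlefield 2. It remains to find a `p < XB` that A will not match. If `XB > XA`, some `p > XA`
works; otherwise the payoffs of the one-battlefield games turn the condition into a quadratic
inequality in `p / XA`, solvable exactly under the square-root hypothesis. -/

lemma winShare_nonneg (x y : ℝ≥0) : 0 ≤ winShare x y := by
  unfold winShare; split_ifs <;> norm_num

lemma winShare_le_one (x y : ℝ≥0) : winShare x y ≤ 1 := by
  unfold winShare; split_ifs <;> norm_num

lemma winShare_swap (x y : ℝ≥0) : winShare y x = 1 - winShare x y := by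
  unfold winShare
  rcases lt_trichotomy x y with h | h | h
  · simp [h, h.not_gt, h.ne]
  · subst h; norm_num
  · simp [h, h.not_gt, h.ne]

lemma measurable_winShare : Measurable (fun z : ℝ≥0 × ℝ≥0 => winShare z.1 z.2) := by
  unfold winShare
  exact Measurable.ite (measurableSet_lt measurable_snd measurable_fst) measurable_const
    (Measurable.ite (measurableSet_eq_fun measurable_fst measurable_snd) measurable_const
      measurable_const)

/-! ### Payoffs as sums over battlefields -/

section Payoff

variable {ι : Type*}

/-- Probability (counting a tie as one half) that the allocation `x` wins battlefield `b`
against an opponent using `F`. -/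
noncomputable def winProb (F : Measure (ι → ℝ≥0)) (b : ι) (x : ℝ≥0) : ℝ :=
  ∫ y, winShare x (y b) ∂F

/-- Expected share of battlefield `b` won by `F` against `F'`. -/
noncomputable def expectedShare (F F' : Measure (ι → ℝ≥0)) (b : ι) : ℝ :=
  ∫ x, winProb F' b (x b) ∂F

/-- Expected allocation to battlefield `b`. -/
noncomputable def meanAllocation (F : Measure (ι → ℝ≥0)) (b : ι) : ℝ :=
  ∫ x, (x b : ℝ) ∂F

lemma integrable_of_mem_Icc {Ω : Type*} [MeasurableSpace Ω] (μ : Measure Ω) [IsFiniteMeasure μ]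
    {f : Ω → ℝ} (hf : Measurable f) (h0 : ∀ x, 0 ≤ f x) (h1 : ∀ x, f x ≤ 1) :
    Integrable f μ :=
  Integrable.of_bound hf.aestronglyMeasurable 1
    (Filter.Eventually.of_forall fun x => by
      rw [Real.norm_eq_abs, abs_of_nonneg (h0 x)]; exact h1 x)

lemma measurable_winShare_apply (b : ι) (x : ℝ≥0) :
    Measurable (fun y : ι → ℝ≥0 => winShare x (y b)) :=
  measurable_winShare.comp (measurable_const.prodMk (measurable_pi_apply b))

lemma integrable_winShare_apply (F : Measure (ι → ℝ≥0)) [IsFiniteMeasure F] (b : ι) (x : ℝ≥0) :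
    Integrable (fun y : ι → ℝ≥0 => winShare x (y b)) F :=
  integrable_of_mem_Icc F (measurable_winShare_apply b x) (fun _ => winShare_nonneg _ _)
    (fun _ => winShare_le_one _ _)

lemma winProb_nonneg (F : Measure (ι → ℝ≥0)) (b : ι) (x : ℝ≥0) : 0 ≤ winProb F b x :=
  integral_nonneg fun _ => winShare_nonneg _ _

lemma winProb_le_one (F : Measure (ι → ℝ≥0)) [IsProbabilityMeasure F] (b : ι) (x : ℝ≥0) :
    winProb F b x ≤ 1 := by
  have := integral_mono (integrable_winShare_apply F b x) (integrable_const (1 : ℝ))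
    (fun y => winShare_le_one x (y b))
  simpa [winProb] using this

lemma measurable_winProb (F : Measure (ι → ℝ≥0)) [IsFiniteMeasure F] (b : ι) :
    Measurable (winProb F b) := by
  have h : Measurable (fun z : ℝ≥0 × (ι → ℝ≥0) => winShare z.1 (z.2 b)) :=
    measurable_winShare.comp (measurable_fst.prodMk ((measurable_pi_apply b).comp measurable_snd))
  exact h.stronglyMeasurable.integral_prod_right.measurable

lemma integrable_winProb_apply (F F' : Measure (ι → ℝ≥0)) [IsFiniteMeasure F]
    [IsProbabilityMeasure F'] (b : ι) : Integrable (fun x => winProb F' b (x b)) F :=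
  integrable_of_mem_Icc F ((measurable_winProb F' b).comp (measurable_pi_apply b))
    (fun _ => winProb_nonneg _ _ _) (fun _ => winProb_le_one _ _ _)

lemma integrable_winShare_prod (F F' : Measure (ι → ℝ≥0)) [IsFiniteMeasure F]
    [IsFiniteMeasure F'] (b : ι) :
    Integrable (fun z : (ι → ℝ≥0) × (ι → ℝ≥0) => winShare (z.1 b) (z.2 b)) (F.prod F') := by
  refine integrable_of_mem_Icc _ ?_ (fun _ => winShare_nonneg _ _) (fun _ => winShare_le_one _ _)
  have h1 : Measurable (fun z : (ι → ℝ≥0) × (ι → ℝ≥0) => (z.1 b, z.2 b)) :=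
    ((measurable_pi_apply b).comp measurable_fst).prodMk
      ((measurable_pi_apply b).comp measurable_snd)
  exact measurable_winShare.comp h1

lemma expectedShare_eq_integral_prod (F F' : Measure (ι → ℝ≥0)) [IsFiniteMeasure F]
    [IsFiniteMeasure F'] (b : ι) :
    expectedShare F F' b = ∫ z, winShare (z.1 b) (z.2 b) ∂(F.prod F') :=
  (integral_prod _ (integrable_winShare_prod F F' b)).symm

lemma expectedShare_swap (F F' : Measure (ι → ℝ≥0)) [IsProbabilityMeasure F]
    [IsProbabilityMeasure F'] (b : ι) : expectedShare F' F b = 1 - expectedShare F F' b := by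
  rw [expectedShare_eq_integral_prod F F', expectedShare_eq_integral_prod F' F,
    ← integral_prod_swap]
  simp only [Prod.fst_swap, Prod.snd_swap]
  simp_rw [fun z : (ι → ℝ≥0) × (ι → ℝ≥0) => winShare_swap (z.1 b) (z.2 b)]
  rw [integral_sub (integrable_const _) (integrable_winShare_prod F F' b)]
  simp

lemma expectedShare_nonneg (F F' : Measure (ι → ℝ≥0)) (b : ι) : 0 ≤ expectedShare F F' b :=
  integral_nonneg fun _ => winProb_nonneg _ _ _

lemma expectedShare_le_one (F F' : Measure (ι → ℝ≥0)) [IsProbabilityMeasure F]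
    [IsProbabilityMeasure F'] (b : ι) : expectedShare F F' b ≤ 1 := by
  have := expectedShare_swap F F' b
  have := expectedShare_nonneg F' F b
  linarith

lemma meanAllocation_nonneg (F : Measure (ι → ℝ≥0)) (b : ι) : 0 ≤ meanAllocation F b :=
  integral_nonneg fun _ => NNReal.coe_nonneg _

lemma one_sub_div_le_winShare {x : ℝ≥0} (hx : 0 < x) (y : ℝ≥0) :
    1 - (y : ℝ) / x ≤ winShare x y := by
  have hx' : (0 : ℝ) < x := hx
  have hy : 0 ≤ (y : ℝ) / x := by positivity
  unfold winShare
  split_ifs with h1 h2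
  · linarith
  · subst h2; rw [div_self hx'.ne']; norm_num
  · have : (x : ℝ) ≤ y := not_lt.1 h1
    have : 1 ≤ (y : ℝ) / x := (one_le_div hx').2 this
    linarith

/-- Markov's inequality in integrated form: an opponent with finite mean is beaten almost surely in
the limit of large allocations. -/
lemma one_sub_div_le_winProb {F : Measure (ι → ℝ≥0)} [IsProbabilityMeasure F] {b : ι}
    (h : Integrable (fun x => (x b : ℝ)) F) {x : ℝ≥0} (hx : 0 < x) :
    1 - meanAllocation F b / x ≤ winProb F b x := by
  have := integral_mono ((integrable_const (1 : ℝ)).sub (h.div_const (x : ℝ)))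
    (integrable_winShare_apply F b x) (fun y => one_sub_div_le_winShare hx (y b))
  simp only [Pi.sub_apply] at this
  rw [integral_sub (integrable_const _) (h.div_const _), integral_div] at this
  simpa [meanAllocation, winProb] using this

variable [Fintype ι]

lemma lottoPayoff_eq_sum (v : ι → ℝ) (F F' : Measure (ι → ℝ≥0)) [IsFiniteMeasure F]
    [IsFiniteMeasure F'] : lottoPayoff v F F' = ∑ b, v b * expectedShare F F' b := by
  unfold lottoPayoff
  rw [integral_finsetSum _ fun b _ => (integrable_winShare_prod F F' b).const_mul (v b)]
  refine Finset.sum_congr rfl fun b _ => ?_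
  rw [integral_const_mul, expectedShare_eq_integral_prod]

lemma lottoPayoff_eq_integral (v : ι → ℝ) (F F' : Measure (ι → ℝ≥0)) [IsFiniteMeasure F]
    [IsProbabilityMeasure F'] :
    lottoPayoff v F F' = ∫ x, ∑ b, v b * winProb F' b (x b) ∂F := by
  rw [lottoPayoff_eq_sum,
    integral_finsetSum _ fun b _ => (integrable_winProb_apply F F' b).const_mul (v b)]
  refine Finset.sum_congr rfl fun b _ => ?_
  rw [integral_const_mul, expectedShare]

lemma IsLottoStrategy.integrable {X : ℝ} {F : Measure (ι → ℝ≥0)} (h : IsLottoStrategy X F)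
    (b : ι) : Integrable (fun x => (x b : ℝ)) F := by
  refine ⟨(measurable_pi_apply b).coe_nnreal_real.aestronglyMeasurable, ?_⟩
  refine lt_of_le_of_lt ?_ (lt_of_le_of_lt h.2 ENNReal.ofReal_lt_top)
  refine lintegral_mono fun x => ?_
  rw [show ‖(x b : ℝ)‖ₑ = (x b : ℝ≥0∞) by simp]
  exact Finset.single_le_sum (f := fun b => (x b : ℝ≥0∞)) (fun _ _ => zero_le) (Finset.mem_univ b)

lemma ofReal_sum_meanAllocation {F : Measure (ι → ℝ≥0)}
    (h : ∀ b, Integrable (fun x => (x b : ℝ)) F) :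
    ENNReal.ofReal (∑ b, meanAllocation F b) = ∫⁻ x, ∑ b, (x b : ℝ≥0∞) ∂F := by
  have h1 : ∑ b, meanAllocation F b = ∫ x, ∑ b, (x b : ℝ) ∂F :=
    (integral_finsetSum _ fun b _ => h b).symm
  rw [h1, ofReal_integral_eq_lintegral_ofReal (integrable_finsetSum _ fun b _ => h b)
    (Filter.Eventually.of_forall fun x => Finset.sum_nonneg fun b _ => NNReal.coe_nonneg _)]
  refine lintegral_congr fun x => ?_
  rw [ENNReal.ofReal_sum_of_nonneg fun b _ => NNReal.coe_nonneg _]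
  simp

lemma IsLottoStrategy.sum_meanAllocation_le {X : ℝ} (hX : 0 ≤ X) {F : Measure (ι → ℝ≥0)}
    (h : IsLottoStrategy X F) : ∑ b, meanAllocation F b ≤ X := by
  have := h.2
  rwa [← ofReal_sum_meanAllocation h.integrable, ENNReal.ofReal_le_ofReal_iff hX] at this

end Payoff

/-! ### Lagrange multipliers for best responses -/

/-- A bounded-resource maximum over two-point lotteries has a linear support with a nonnegative
multiplier. -/
lemma exists_multiplier {E : Type*} {φ s : E → ℝ} {X V : ℝ} {x₀ : E} (hx₀ : s x₀ < X)
    (h : ∀ x y t, 0 ≤ t → t ≤ 1 → t * s x + (1 - t) * s y ≤ X →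
      t * φ x + (1 - t) * φ y ≤ V) :
    ∃ l : ℝ, 0 ≤ l ∧ ∀ x, φ x ≤ V + l * (s x - X) := by
  have hle : ∀ x, s x ≤ X → φ x ≤ V := fun x hx => by
    have := h x x 1 zero_le_one le_rfl (by linarith)
    linarith
  -- The lottery between `x` and `y` whose expected cost is exactly `X` compares the slopes on the
  -- two sides of the budget.
  have hslope : ∀ x y, s x < X → X < s y → (φ y - V) / (s y - X) ≤ (V - φ x) / (X - s x) := by
    intro x y hx hy
    have hd : 0 < s y - s x := by linarith
    have key := h x y ((s y - X) / (s y - s x)) (div_nonneg (by linarith) hd.le)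
      ((div_le_one hd).2 (by linarith)) (by
        apply le_of_eq; field_simp; ring)
    rw [div_le_div_iff₀ (by linarith) (by linarith)]
    have e : (s y - X) / (s y - s x) * φ x + (1 - (s y - X) / (s y - s x)) * φ y
        = ((s y - X) * φ x + (X - s x) * φ y) / (s y - s x) := by
      field_simp; ring
    rw [e, div_le_iff₀ hd] at key
    nlinarith
  -- Inserting `0` makes the supremum nonnegative and keeps the set nonempty when no point costs
  -- more than `X`.
  let T : Set ℝ := insert 0 {c | ∃ y, X < s y ∧ c = (φ y - V) / (s y - X)}
  have hT : ∀ x, s x < X → ∀ c ∈ T, c ≤ (V - φ x) / (X - s x) := by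
    rintro x hx c (rfl | ⟨y, hy, rfl⟩)
    · exact div_nonneg (by linarith [hle x hx.le]) (by linarith)
    · exact hslope x y hx hy
  have hbdd : BddAbove T := ⟨_, hT x₀ hx₀⟩
  refine ⟨sSup T, le_csSup hbdd (Set.mem_insert _ _), fun x => ?_⟩
  rcases lt_trichotomy (s x) X with hx | hx | hx
  · have h1 := csSup_le (Set.insert_nonempty _ _) (hT x hx)
    rw [le_div_iff₀ (by linarith)] at h1
    linarith
  · have := hle x hx.le
    simpa [hx] using this
  · have h1 : (φ x - V) / (s x - X) ≤ sSup T :=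
      le_csSup hbdd (Set.mem_insert_of_mem _ ⟨x, hx, rfl⟩)
    rw [div_le_iff₀ (by linarith)] at h1
    linarith

section BestResponse

variable {ι : Type*}

/-- The lottery between two allocation vectors. -/
noncomputable def twoPoint (x y : ι → ℝ≥0) (t : ℝ) : Measure (ι → ℝ≥0) :=
  ENNReal.ofReal t • Measure.dirac x + ENNReal.ofReal (1 - t) • Measure.dirac y

lemma isProbabilityMeasure_twoPoint (x y : ι → ℝ≥0) {t : ℝ} (h0 : 0 ≤ t) (h1 : t ≤ 1) :
    IsProbabilityMeasure (twoPoint x y t) := by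
  constructor
  simp only [twoPoint, Measure.add_apply, Measure.smul_apply, measure_univ, smul_eq_mul, mul_one]
  rw [← ENNReal.ofReal_add h0 (by linarith)]
  simp

lemma integral_twoPoint [Finite ι] (x y : ι → ℝ≥0) {t : ℝ} (h0 : 0 ≤ t) (h1 : t ≤ 1)
    (f : (ι → ℝ≥0) → ℝ) : ∫ z, f z ∂(twoPoint x y t) = t * f x + (1 - t) * f y := by
  have hx : Integrable f (Measure.dirac x) := integrable_dirac (by simp)
  have hy : Integrable f (Measure.dirac y) := integrable_dirac (by simp)
  rw [twoPoint, integral_add_measure (hx.smul_measure ENNReal.ofReal_ne_top)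
    (hy.smul_measure ENNReal.ofReal_ne_top), integral_smul_measure, integral_smul_measure,
    integral_dirac, integral_dirac, ENNReal.toReal_ofReal h0,
    ENNReal.toReal_ofReal (by linarith)]
  rfl

variable [Fintype ι]

lemma isLottoStrategy_twoPoint (x y : ι → ℝ≥0) {t X : ℝ} (h0 : 0 ≤ t) (h1 : t ≤ 1)
    (h : t * ∑ b, (x b : ℝ) + (1 - t) * ∑ b, (y b : ℝ) ≤ X) :
    IsLottoStrategy X (twoPoint x y t) := by
  refine ⟨isProbabilityMeasure_twoPoint x y h0 h1, ?_⟩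
  have hc : ∀ z : ι → ℝ≥0, ∑ b, (z b : ℝ≥0∞) = ENNReal.ofReal (∑ b, (z b : ℝ)) := fun z => by
    rw [ENNReal.ofReal_sum_of_nonneg fun b _ => NNReal.coe_nonneg _]
    simp
  rw [twoPoint, lintegral_add_measure, lintegral_smul_measure, lintegral_smul_measure,
    lintegral_dirac, lintegral_dirac, hc, hc, smul_eq_mul, smul_eq_mul, ← ENNReal.ofReal_mul h0,
    ← ENNReal.ofReal_mul (by linarith), ← ENNReal.ofReal_add]
  · exact ENNReal.ofReal_le_ofReal h
  · exact mul_nonneg h0 (Finset.sum_nonneg fun b _ => NNReal.coe_nonneg _)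
  · exact mul_nonneg (by linarith) (Finset.sum_nonneg fun b _ => NNReal.coe_nonneg _)

/-- A best response maximizes payoff minus a linear cost of the resource, with complementary
slackness. -/
lemma bestResponse_multiplier {v : ι → ℝ} {X : ℝ} (hX : 0 < X) {F F' : Measure (ι → ℝ≥0)}
    (hF : IsLottoStrategy X F) [IsProbabilityMeasure F']
    (hbest : ∀ H, IsLottoStrategy X H → lottoPayoff v H F' ≤ lottoPayoff v F F') :
    ∃ l : ℝ, 0 ≤ l ∧
      (∀ x : ι → ℝ≥0, ∑ b, v b * winProb F' b (x b) ≤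
        lottoPayoff v F F' + l * (∑ b, (x b : ℝ) - X)) ∧
      l * ∑ b, meanAllocation F b = l * X := by
  have := hF.1
  obtain ⟨l, hl, h⟩ := exists_multiplier (E := ι → ℝ≥0)
    (φ := fun x => ∑ b, v b * winProb F' b (x b)) (s := fun x => ∑ b, (x b : ℝ)) (X := X)
    (V := lottoPayoff v F F') (x₀ := 0) (by simpa using hX) (by
      intro x y t h0 h1 hs
      have := isProbabilityMeasure_twoPoint x y h0 h1
      have h2 := hbest _ (isLottoStrategy_twoPoint x y h0 h1 hs)
      rwa [lottoPayoff_eq_integral v (twoPoint x y t), integral_twoPoint x y h0 h1] at h2)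
  refine ⟨l, hl, h, le_antisymm
    (mul_le_mul_of_nonneg_left (hF.sum_meanAllocation_le hX.le) hl) ?_⟩
  have hi : Integrable (fun x : ι → ℝ≥0 => ∑ b, (x b : ℝ)) F :=
    integrable_finsetSum _ fun b _ => hF.integrable b
  have hi2 : Integrable (fun x : ι → ℝ≥0 => l * (∑ b, (x b : ℝ) - X)) F :=
    (hi.sub (integrable_const X)).const_mul l
  -- Averaging the support inequality over `F` itself returns the equilibrium payoff on the left, so
  -- the budget term cannot be negative.
  have h2 := integral_mono
    (integrable_finsetSum Finset.univ fun b _ => (integrable_winProb_apply F F' b).const_mul (v b))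
    ((integrable_const (lottoPayoff v F F')).add hi2) h
  rw [← lottoPayoff_eq_integral] at h2
  simp only [Pi.add_apply] at h2
  rw [integral_add (integrable_const _) hi2, integral_const_mul,
    integral_sub hi (integrable_const _), integral_finsetSum _ fun b _ => hF.integrable b] at h2
  simp only [integral_const, probReal_univ, one_smul] at h2
  change _ ≤ _ + l * (∑ b, meanAllocation F b - X) at h2
  linarith

/-- The multiplier condition separates across battlefields. -/
lemma bestResponse_battlefield {v : ι → ℝ} {X : ℝ} {F F' : Measure (ι → ℝ≥0)}
    (hF : IsLottoStrategy X F) [IsProbabilityMeasure F'] {l : ℝ}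
    (h : ∀ x : ι → ℝ≥0, ∑ b, v b * winProb F' b (x b) ≤
        lottoPayoff v F F' + l * (∑ b, (x b : ℝ) - X))
    (hs : l * ∑ b, meanAllocation F b = l * X) (b : ι) (x : ℝ≥0) :
    v b * winProb F' b x - l * x ≤ v b * expectedShare F F' b - l * meanAllocation F b := by
  classical
  have := hF.1
  -- Only coordinate `b` of `z` is replaced by `x`. After averaging `z` over `F`, the other
  -- battlefields contribute their equilibrium values and cancel.
  have h1 : ∀ z : ι → ℝ≥0, v b * winProb F' b x - l * x +
      ∑ c ∈ Finset.univ.erase b, (v c * winProb F' c (z c) - l * z c) ≤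
      lottoPayoff v F F' - l * X := fun z => by
    have := h (Function.update z b x)
    rw [← Finset.add_sum_erase _ _ (Finset.mem_univ b),
      ← Finset.add_sum_erase _ (fun c => ((Function.update z b x c : ℝ≥0) : ℝ))
        (Finset.mem_univ b)] at this
    have e1 : ∑ c ∈ Finset.univ.erase b, v c * winProb F' c (Function.update z b x c) =
        ∑ c ∈ Finset.univ.erase b, v c * winProb F' c (z c) :=
      Finset.sum_congr rfl fun c hc => by
        rw [Function.update_of_ne (Finset.ne_of_mem_erase hc)]
    have e2 : ∑ c ∈ Finset.univ.erase b, ((Function.update z b x c : ℝ≥0) : ℝ) =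
        ∑ c ∈ Finset.univ.erase b, (z c : ℝ) :=
      Finset.sum_congr rfl fun c hc => by
        rw [Function.update_of_ne (Finset.ne_of_mem_erase hc)]
    rw [e1, e2] at this
    simp only [Function.update_self] at this
    rw [Finset.sum_sub_distrib, ← Finset.mul_sum]
    linarith
  have hi : ∀ c, Integrable (fun z : ι → ℝ≥0 => v c * winProb F' c (z c) - l * z c) F := fun c =>
    ((integrable_winProb_apply F F' c).const_mul _).sub ((hF.integrable c).const_mul _)
  have h2 := integral_mono
    ((integrable_const (v b * winProb F' b x - l * x)).add
      (integrable_finsetSum (Finset.univ.erase b) fun c _ => hi c))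
    (integrable_const (lottoPayoff v F F' - l * X)) h1
  simp only [Pi.add_apply] at h2
  rw [integral_add (integrable_const _) (integrable_finsetSum _ fun c _ => hi c),
    integral_finsetSum _ fun c _ => hi c] at h2
  simp only [integral_const, probReal_univ, one_smul] at h2
  have e3 : ∀ c, ∫ z, (v c * winProb F' c (z c) - l * z c) ∂F =
      v c * expectedShare F F' c - l * meanAllocation F c := fun c => by
    rw [integral_sub ((integrable_winProb_apply F F' c).const_mul _)
      ((hF.integrable c).const_mul _), integral_const_mul, integral_const_mul]
    rfl
  simp only [e3] at h2
  rw [lottoPayoff_eq_sum, ← hs, Finset.mul_sum, ← Finset.sum_sub_distrib,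
    ← Finset.add_sum_erase _ _ (Finset.mem_univ b)] at h2
  linarith

end BestResponse

/-! ### Uniqueness of the all-pay outcome -/

section AllPay

variable {ι : Type*}

lemma one_sub_winProb_le (F : Measure (ι → ℝ≥0)) [IsProbabilityMeasure F] (b : ι) (x : ℝ≥0) :
    1 - winProb F b x ≤ F.real {y | (x : ℝ) ≤ y b} := by
  have hm : MeasurableSet {y : ι → ℝ≥0 | (x : ℝ) ≤ y b} :=
    measurableSet_le measurable_const (measurable_pi_apply b).coe_nnreal_real
  have hle : ∀ y : ι → ℝ≥0, 1 - winShare x (y b) ≤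
      Set.indicator {y : ι → ℝ≥0 | (x : ℝ) ≤ y b} (fun _ => (1 : ℝ)) y := fun y => by
    by_cases h : (x : ℝ) ≤ y b
    · rw [Set.indicator_of_mem (by exact h)]
      linarith [winShare_nonneg x (y b)]
    · rw [Set.indicator_of_notMem (by exact h)]
      have : y b < x := not_le.1 h
      simp [winShare, this]
  have h1 := integral_mono ((integrable_const (1 : ℝ)).sub (integrable_winShare_apply F b x))
    ((integrable_const (1 : ℝ)).indicator hm) hle
  simp only [Pi.sub_apply] at h1
  rw [integral_sub (integrable_const _) (integrable_winShare_apply F b x),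
    integral_indicator_const _ hm] at h1
  simpa [winProb] using h1

/-- If no allocation earns more than `m` in the all-pay contest with prize `a` against `F`, then
`F` has to spend at least `(a - m) ^ 2 / (2 * a)`. -/
lemma le_meanAllocation {F : Measure (ι → ℝ≥0)} [IsProbabilityMeasure F] {b : ι}
    (hi : Integrable (fun x => (x b : ℝ)) F) {a m : ℝ} (ha : 0 < a) (hma : m ≤ a)
    (h : ∀ x : ℝ≥0, a * winProb F b x - x ≤ m) :
    (a - m) ^ 2 / (2 * a) ≤ meanAllocation F b := by
  have hs : 0 ≤ a - m := by linarith
  rw [← ENNReal.ofReal_le_ofReal_iff (meanAllocation_nonneg F b), meanAllocation,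
    ofReal_integral_eq_lintegral_ofReal hi
      (Filter.Eventually.of_forall fun x => NNReal.coe_nonneg _),
    lintegral_eq_lintegral_meas_le F (Filter.Eventually.of_forall fun x => NNReal.coe_nonneg _)
      (measurable_pi_apply b).coe_nnreal_real.aemeasurable]
  have hint : ∫ t in (0 : ℝ)..(a - m), (a - m - t) / a = (a - m) ^ 2 / (2 * a) := by
    rw [intervalIntegral.integral_div, intervalIntegral.integral_sub (by simp) (by simp)]
    simp
    field_simp
    ring
  have hnn : ∀ t ∈ Set.Ioc 0 (a - m), 0 ≤ (a - m - t) / a := fun t ht =>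
    div_nonneg (by linarith [ht.2]) ha.le
  rw [← hint, intervalIntegral.integral_of_le hs, ofReal_integral_eq_lintegral_ofReal]
  -- Layer-cake formula: bidding `t` earns at most `m`, so the opponent must bid at least `t` with
  -- probability at least `(a - m - t) / a`.
  · calc ∫⁻ t in Set.Ioc 0 (a - m), ENNReal.ofReal ((a - m - t) / a)
        ≤ ∫⁻ t in Set.Ioc 0 (a - m), F {y | t ≤ y b} := by
          refine setLIntegral_mono' measurableSet_Ioc fun t ht => ?_
          have h1 := h (.mk t ht.1.le)
          have h2 := one_sub_winProb_le F b (.mk t ht.1.le)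
          rw [NNReal.coe_mk] at h1 h2
          have h3 : (a - m - t) / a ≤ F.real {y | t ≤ y b} := by
            refine le_trans ?_ h2
            rw [div_le_iff₀ ha]
            linarith
          rw [← ofReal_measureReal]
          exact ENNReal.ofReal_le_ofReal h3
      _ ≤ ∫⁻ t in Set.Ioi (0 : ℝ), F {y | t ≤ y b} :=
          lintegral_mono_set fun t ht => ht.1
  · exact (by fun_prop : Continuous fun t : ℝ => (a - m - t) / a).integrableOn_Ioc
  · exact (ae_restrict_iff' measurableSet_Ioc).2 (Filter.Eventually.of_forall hnn)

/-- Numerical core of the uniqueness of equilibrium in the two-player all-pay auction with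
valuations `a ≥ b`. -/
lemma allPay_unique {a b P x y mA mB : ℝ} (hb : 0 < b) (hab : b ≤ a)
    (hA : mA = a * P - x) (hB : mB = b * (1 - P) - y) (hB0 : 0 ≤ mB)
    (hy : (a - mA) ^ 2 / (2 * a) ≤ y) (hx : (b - mB) ^ 2 / (2 * b) ≤ x) (hmB : mB ≤ b) :
    x = b / 2 ∧ y = b ^ 2 / (2 * a) ∧ P = 1 - b / (2 * a) := by
  have ha : 0 < a := by linarith
  rw [div_le_iff₀ (by positivity)] at hy hx
  -- The identity `e` eliminates `P`. The two effort bounds then place `(a - mA, b - mB)` in a disc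
  -- around `(b, a)` of radius `a - b`, which meets the half-plane `0 ≤ mB` only at `mA = a - b`,
  -- `mB = 0`.
  have key : (a - mA - b) ^ 2 + (b - mB - a) ^ 2 ≤ (a - b) ^ 2 := by
    have e : b * mA + a * mB + b * x + a * y = a * b := by rw [hA, hB]; ring
    nlinarith
  have h2 : (a - b) ^ 2 ≤ (b - mB - a) ^ 2 := by nlinarith
  have h3 : mA = a - b := by nlinarith [sq_nonneg (a - mA - b)]
  have h4 : mB = 0 := by
    have : (b - mB - a) ^ 2 ≤ (a - b) ^ 2 := by nlinarith [sq_nonneg (a - mA - b)]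
    nlinarith
  subst h4
  rw [h3] at hA hy
  have hP : a * P = a - b + x := by linarith
  have hx2 : b / 2 ≤ x := by nlinarith
  have e : a * y = b * (b - x) := by
    have : y = b * (1 - P) := by linarith
    rw [this]
    linear_combination (-b) * hP
  have hx3 : x ≤ b / 2 := by nlinarith
  have hx4 : x = b / 2 := le_antisymm hx3 hx2
  refine ⟨hx4, ?_, ?_⟩
  · rw [hx4] at e; field_simp; linarith
  · rw [hx4] at hP; field_simp; linarith

/-- In an all-pay contest with prizes `a` and `b`, the expected effort `x`, `y` of the two
players and the win probability `P` of the first one. -/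
def IsAllPayOutcome (a b P x y : ℝ) : Prop :=
  (b ≤ a → x = b / 2 ∧ y = b ^ 2 / (2 * a) ∧ P = 1 - b / (2 * a)) ∧
  (a ≤ b → y = a / 2 ∧ x = a ^ 2 / (2 * b) ∧ P = a / (2 * b))

/-- Bidding zero shows that both rents are nonnegative, and `le_meanAllocation` bounds each player's
effort below by the other's rent. These facts feed `allPay_unique`, with the roles exchanged when `a
≤ b`. -/
lemma isAllPayOutcome {F F' : Measure (ι → ℝ≥0)} [IsProbabilityMeasure F]
    [IsProbabilityMeasure F'] {c : ι} (hi : Integrable (fun x => (x c : ℝ)) F)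
    (hi' : Integrable (fun x => (x c : ℝ)) F') {a b : ℝ} (ha : 0 < a) (hb : 0 < b)
    (hA : ∀ x : ℝ≥0, a * winProb F' c x - x ≤ a * expectedShare F F' c - meanAllocation F c)
    (hB : ∀ x : ℝ≥0, b * winProb F c x - x ≤ b * expectedShare F' F c - meanAllocation F' c) :
    IsAllPayOutcome a b (expectedShare F F' c) (meanAllocation F c) (meanAllocation F' c) := by
  have hA0 : 0 ≤ a * expectedShare F F' c - meanAllocation F c := by
    refine le_trans ?_ (hA 0)
    simpa using mul_nonneg ha.le (winProb_nonneg F' c 0)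
  have hB0 : 0 ≤ b * expectedShare F' F c - meanAllocation F' c := by
    refine le_trans ?_ (hB 0)
    simpa using mul_nonneg hb.le (winProb_nonneg F c 0)
  have hAa : a * expectedShare F F' c - meanAllocation F c ≤ a := by
    nlinarith [expectedShare_le_one F F' c, meanAllocation_nonneg F c]
  have hBb : b * expectedShare F' F c - meanAllocation F' c ≤ b := by
    nlinarith [expectedShare_le_one F' F c, meanAllocation_nonneg F' c]
  have hy := le_meanAllocation hi' ha hAa hA
  have hx := le_meanAllocation hi hb hBb hB
  have hsw := expectedShare_swap F F' c
  refine ⟨fun hab => allPay_unique hb hab rfl (by rw [hsw]) hB0 hy hx hBb, fun hab => ?_⟩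
  have hsw' := expectedShare_swap F' F c
  obtain ⟨h1, h2, h3⟩ := allPay_unique ha hab rfl (by rw [hsw']) hA0 hx hy hAa
  refine ⟨h1, h2, ?_⟩
  rw [hsw', h3]; ring

end AllPay

/-! ### Equilibria as families of all-pay contests -/

section Equilibrium

variable {ι : Type*} [Fintype ι]

/-- If the resource is free, allocating `1 / t` everywhere with `t` small wins all but `O(t)` of the
total value. -/
lemma sum_le_of_forall_winProb_le {v : ι → ℝ} (hv : ∀ b, 0 ≤ v b) {F : Measure (ι → ℝ≥0)}
    [IsProbabilityMeasure F] (hi : ∀ b, Integrable (fun x => (x b : ℝ)) F) {V : ℝ}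
    (h : ∀ x : ι → ℝ≥0, ∑ b, v b * winProb F b (x b) ≤ V) : ∑ b, v b ≤ V := by
  set C := ∑ b, v b * meanAllocation F b with hC
  have h1 : ∀ t : ℝ, 0 < t → ∑ b, v b - C * t ≤ V := fun t ht => by
    have ht' : 0 < t⁻¹ := inv_pos.2 ht
    refine le_trans ?_ (h fun _ => .mk t⁻¹ ht'.le)
    rw [hC, Finset.sum_mul, ← Finset.sum_sub_distrib]
    refine Finset.sum_le_sum fun b _ => ?_
    have := one_sub_div_le_winProb (hi b) (x := .mk t⁻¹ ht'.le) ht'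
    rw [NNReal.coe_mk, div_inv_eq_mul] at this
    nlinarith [hv b, mul_le_mul_of_nonneg_left this (hv b)]
  by_contra hlt
  push Not at hlt
  have hC0 : 0 ≤ C := Finset.sum_nonneg fun b _ => mul_nonneg (hv b) (meanAllocation_nonneg F b)
  have := h1 ((∑ b, v b - V) / (2 * (C + 1))) (by apply div_pos <;> linarith)
  have h2 : C * ((∑ b, v b - V) / (2 * (C + 1))) ≤ (∑ b, v b - V) / 2 := by
    rw [← mul_div_assoc, div_le_div_iff₀ (by linarith) (by norm_num)]
    nlinarith
  linarith

/-- A player whose opponent has a positive budget has a positive multiplier. -/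
lemma multiplier_pos [Nonempty ι] {v v' : ι → ℝ} (hv : ∀ b, 0 < v b) (hv' : ∀ b, 0 < v' b)
    {X' : ℝ} (hX' : 0 < X') {F F' : Measure (ι → ℝ≥0)} [IsProbabilityMeasure F]
    [IsProbabilityMeasure F'] (hi : ∀ b, Integrable (fun x => (x b : ℝ)) F)
    (hi' : ∀ b, Integrable (fun x => (x b : ℝ)) F') {X l l' : ℝ} (hl : 0 ≤ l) (hl' : 0 ≤ l')
    (h : ∀ x : ι → ℝ≥0, ∑ b, v b * winProb F' b (x b) ≤
        lottoPayoff v F F' + l * (∑ b, (x b : ℝ) - X))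
    (h' : ∀ x : ι → ℝ≥0, ∑ b, v' b * winProb F b (x b) ≤
        lottoPayoff v' F' F + l' * (∑ b, (x b : ℝ) - X')) : 0 < l := by
  -- With `l = 0` the first player wins everything. The opponent then earns nothing, and the zero
  -- allocation forces `l' = 0` as well, so the opponent would also have to win everything.
  refine lt_of_le_of_ne hl fun hl0 => ?_
  subst hl0
  have hV := sum_le_of_forall_winProb_le (fun b => (hv b).le) hi' (V := lottoPayoff v F F')
    (by simpa using h)
  rw [lottoPayoff_eq_sum] at hV
  have hone : ∀ b, expectedShare F F' b = 1 := by
    have h0 : ∑ b, v b * (1 - expectedShare F F' b) ≤ 0 := by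
      simp only [mul_sub, mul_one, Finset.sum_sub_distrib]; linarith
    have hnn : ∀ b ∈ Finset.univ, 0 ≤ v b * (1 - expectedShare F F' b) := fun b _ =>
      mul_nonneg (hv b).le (by linarith [expectedShare_le_one F F' b])
    have h1 := (Finset.sum_eq_zero_iff_of_nonneg hnn).1 (le_antisymm h0 (Finset.sum_nonneg hnn))
    intro b
    rcases mul_eq_zero.1 (h1 b (Finset.mem_univ b)) with h2 | h2
    · exact absurd h2 (hv b).ne'
    · linarith
  have hV' : lottoPayoff v' F' F = 0 := by
    rw [lottoPayoff_eq_sum]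
    refine Finset.sum_eq_zero fun b _ => ?_
    rw [expectedShare_swap F F', hone]; simp
  rw [hV'] at h'
  have hl0 : l' = 0 := by
    have h1 := h' 0
    have h2 : 0 ≤ ∑ b, v' b * winProb F b ((0 : ι → ℝ≥0) b) :=
      Finset.sum_nonneg fun b _ => mul_nonneg (hv' b).le (winProb_nonneg _ _ _)
    simp at h1 h2
    nlinarith
  subst hl0
  have h3 := sum_le_of_forall_winProb_le (fun b => (hv' b).le) hi (V := 0) (by simpa using h')
  exact absurd h3 (not_le.2 (Finset.sum_pos (fun b _ => hv' b) Finset.univ_nonempty))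

/-- In an equilibrium with positive budgets and valuations every battlefield is an all-pay
contest, with prizes scaled by one factor for each player. -/
theorem LottoGame.IsEquilibrium.exists_allPay [Nonempty ι] {G : LottoGame ι} (hXA : 0 < G.XA)
    (hXB : 0 < G.XB) (hvA : ∀ b, 0 < G.vA b) (hvB : ∀ b, 0 < G.vB b)
    {FA FB : Measure (ι → ℝ≥0)} (h : G.IsEquilibrium FA FB) :
    ∃ (k m : ℝ) (P x y : ι → ℝ), 0 < k ∧ 0 < m ∧
      (∀ b, IsAllPayOutcome (k * G.vA b) (m * G.vB b) (P b) (x b) (y b)) ∧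
      ∑ b, x b = G.XA ∧ ∑ b, y b = G.XB ∧
      lottoPayoff G.vA FA FB = ∑ b, G.vA b * P b ∧
      lottoPayoff G.vB FB FA = ∑ b, G.vB b * (1 - P b) := by
  obtain ⟨hA, hB, hbA, hbB⟩ := h
  have := hA.1
  have := hB.1
  obtain ⟨l, hl, h1, h2⟩ := bestResponse_multiplier hXA hA hbA
  obtain ⟨l', hl', h1', h2'⟩ := bestResponse_multiplier hXB hB hbB
  have hlp := multiplier_pos hvA hvB hXB hA.integrable hB.integrable hl hl' h1 h1'
  have hlp' := multiplier_pos hvB hvA hXA hB.integrable hA.integrable hl' hl h1' h1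
  refine ⟨l⁻¹, l'⁻¹, expectedShare FA FB, meanAllocation FA, meanAllocation FB, inv_pos.2 hlp,
    inv_pos.2 hlp', fun b => ?_, mul_left_cancel₀ hlp.ne' h2, mul_left_cancel₀ hlp'.ne' h2',
    lottoPayoff_eq_sum _ _ _, ?_⟩
  · refine isAllPayOutcome (hA.integrable b) (hB.integrable b)
      (mul_pos (inv_pos.2 hlp) (hvA b)) (mul_pos (inv_pos.2 hlp') (hvB b)) (fun x => ?_)
      (fun x => ?_)
    · have := bestResponse_battlefield hA h1 h2 b x
      rw [← mul_le_mul_iff_right₀ hlp]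
      field_simp
      linarith
    · have := bestResponse_battlefield hB h1' h2' b x
      rw [← mul_le_mul_iff_right₀ hlp']
      field_simp
      linarith
  · rw [lottoPayoff_eq_sum]
    exact Finset.sum_congr rfl fun b _ => by rw [expectedShare_swap FA FB]

end Equilibrium

/-! ### The game on one battlefield -/

section SingleBattlefield

variable {ι : Type*}

/-- The distribution of a constant allocation vector that is uniform on `(0, T]`. -/
noncomputable def uniformAllocation (ι : Type*) (T : ℝ) : Measure (ι → ℝ≥0) :=
  Measure.map (fun t : ℝ => fun _ => (T * t).toNNReal) (volume.restrict (Set.Ioc 0 1))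

lemma measurable_uniformAllocation_map (T : ℝ) :
    Measurable (fun t : ℝ => fun _ : ι => (T * t).toNNReal) :=
  measurable_pi_lambda _ fun _ => (measurable_const.mul measurable_id).real_toNNReal

instance isProbabilityMeasure_uniformAllocation (T : ℝ) :
    IsProbabilityMeasure (uniformAllocation ι T) := by
  have : IsProbabilityMeasure ((volume : Measure ℝ).restrict (Set.Ioc 0 1)) := ⟨by simp⟩
  exact Measure.isProbabilityMeasure_map (measurable_uniformAllocation_map T).aemeasurable

lemma lintegral_uniformAllocation {T : ℝ} (hT : 0 ≤ T) (b : ι) :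
    ∫⁻ x, (x b : ℝ≥0∞) ∂(uniformAllocation ι T) = ENNReal.ofReal (T / 2) := by
  rw [uniformAllocation, lintegral_map (measurable_pi_apply b).coe_nnreal_ennreal
    (measurable_uniformAllocation_map T)]
  have h : ∫ t in (0 : ℝ)..1, T * t = T / 2 := by
    rw [intervalIntegral.integral_const_mul, integral_id]; ring
  rw [← h, intervalIntegral.integral_of_le zero_le_one, ofReal_integral_eq_lintegral_ofReal]
  · rfl
  · exact (continuous_const.mul continuous_id).integrableOn_Ioc
  · exact (ae_restrict_iff' measurableSet_Ioc).2
      (Filter.Eventually.of_forall fun t ht => mul_nonneg hT ht.1.le)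

lemma winProb_uniformAllocation_le {T : ℝ} (hT : 0 < T) (b : ι) (x : ℝ≥0) :
    winProb (uniformAllocation ι T) b x ≤ x / T := by
  have hm : MeasurableSet (Set.Ioc (0 : ℝ) (x / T)) := measurableSet_Ioc
  rw [winProb, uniformAllocation, integral_map (measurable_uniformAllocation_map T).aemeasurable
    (measurable_winShare_apply b x).aestronglyMeasurable]
  have hle : ∫ t in Set.Ioc (0 : ℝ) 1, winShare x (T * t).toNNReal ≤
      ∫ t in Set.Ioc (0 : ℝ) 1, (Set.Ioc (0 : ℝ) (x / T)).indicator (fun _ => (1 : ℝ)) t := by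
    refine setIntegral_mono_on ?_ ((integrable_const _).indicator hm) measurableSet_Ioc
      fun t ht => ?_
    · have h1 : Measurable fun t : ℝ => winShare x (T * t).toNNReal :=
        (measurable_winShare_apply b x).comp (measurable_uniformAllocation_map T)
      exact integrable_of_mem_Icc _ h1 (fun _ => winShare_nonneg _ _)
        (fun _ => winShare_le_one _ _)
    · by_cases h : t ≤ x / T
      · rw [Set.indicator_of_mem (Set.mem_Ioc.2 ⟨ht.1, h⟩)]
        exact winShare_le_one _ _
      · rw [Set.indicator_of_notMem fun h' => h h'.2]
        have h1 : x < (T * t).toNNReal := by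
          rw [Real.lt_toNNReal_iff_coe_lt]
          have := (div_lt_iff₀ hT).1 (not_le.1 h)
          linarith
        simp [winShare, h1.not_gt, h1.ne]
  refine hle.trans ?_
  rw [integral_indicator_const _ hm, smul_eq_mul, mul_one, measureReal_restrict_apply hm]
  refine (measureReal_mono Set.inter_subset_left (by simp)).trans ?_
  rw [Real.volume_real_Ioc_of_le (by positivity), sub_zero]

/-- Staying at zero with probability `1 - q` and using the uniform allocation otherwise. -/
noncomputable def zeroUniformMix (ι : Type*) (T q : ℝ) : Measure (ι → ℝ≥0) :=
  ENNReal.ofReal (1 - q) • Measure.dirac 0 + ENNReal.ofReal q • uniformAllocation ι T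

lemma isProbabilityMeasure_zeroUniformMix {T q : ℝ} (h0 : 0 ≤ q) (h1 : q ≤ 1) :
    IsProbabilityMeasure (zeroUniformMix ι T q) := by
  constructor
  simp only [zeroUniformMix, Measure.add_apply, Measure.smul_apply, measure_univ, smul_eq_mul,
    mul_one]
  rw [← ENNReal.ofReal_add (by linarith) h0]
  simp

lemma integral_zeroUniformMix [Finite ι] {T q : ℝ} (h0 : 0 ≤ q) (h1 : q ≤ 1)
    {f : (ι → ℝ≥0) → ℝ} (hf : Integrable f (uniformAllocation ι T)) :
    ∫ x, f x ∂(zeroUniformMix ι T q) =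
      (1 - q) * f 0 + q * ∫ x, f x ∂(uniformAllocation ι T) := by
  have hx : Integrable f (Measure.dirac 0) := integrable_dirac (by simp)
  rw [zeroUniformMix, integral_add_measure (hx.smul_measure ENNReal.ofReal_ne_top)
    (hf.smul_measure ENNReal.ofReal_ne_top), integral_smul_measure, integral_smul_measure,
    integral_dirac, ENNReal.toReal_ofReal h0, ENNReal.toReal_ofReal (by linarith)]
  rfl

lemma winProb_zeroUniformMix_le [Finite ι] {T q : ℝ} (hT : 0 < T) (h0 : 0 ≤ q) (h1 : q ≤ 1)
    (b : ι) (x : ℝ≥0) : winProb (zeroUniformMix ι T q) b x ≤ 1 - q + q * (x / T) := by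
  rw [winProb, integral_zeroUniformMix h0 h1 (integrable_winShare_apply _ b x)]
  have := winProb_uniformAllocation_le hT b x
  have h2 := winShare_le_one x ((0 : ι → ℝ≥0) b)
  rw [winProb] at this
  nlinarith [mul_le_mul_of_nonneg_left this h0,
    mul_le_mul_of_nonneg_left h2 (by linarith : 0 ≤ 1 - q)]

lemma expectedShare_uniformAllocation_self (T : ℝ) (b : ι) :
    expectedShare (uniformAllocation ι T) (uniformAllocation ι T) b = 1 / 2 := by
  have := expectedShare_swap (uniformAllocation ι T) (uniformAllocation ι T) b
  linarith

lemma expectedShare_zeroUniformMix [Finite ι] {T q : ℝ} (hT : 0 < T) (h0 : 0 ≤ q) (h1 : q ≤ 1)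
    (b : ι) : expectedShare (zeroUniformMix ι T q) (uniformAllocation ι T) b = q / 2 := by
  rw [expectedShare, integral_zeroUniformMix h0 h1 (integrable_winProb_apply _ _ b)]
  have h2 := expectedShare_uniformAllocation_self T b
  rw [expectedShare] at h2
  have h3 : winProb (uniformAllocation ι T) b ((0 : ι → ℝ≥0) b) = 0 := by
    refine le_antisymm ?_ (winProb_nonneg _ _ _)
    simpa using winProb_uniformAllocation_le hT b 0
  rw [h2, h3]; ring

/-- Against an affine bound on the win probability only the mean of `F` matters; this is how
deviations are controlled in `exists_isEquilibrium_of_unique`. -/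
lemma expectedShare_le_of_winProb_le [Fintype ι] {F F' : Measure (ι → ℝ≥0)}
    [IsProbabilityMeasure F] [IsProbabilityMeasure F'] {b : ι}
    (hi : Integrable (fun x => (x b : ℝ)) F) {c d : ℝ}
    (h : ∀ x : ℝ≥0, winProb F' b x ≤ c + d * x) :
    expectedShare F F' b ≤ c + d * meanAllocation F b := by
  have := integral_mono (integrable_winProb_apply F F' b)
    ((integrable_const c).add (hi.const_mul d)) (fun x => h (x b))
  simp only [Pi.add_apply] at this
  rw [integral_add (integrable_const _) (hi.const_mul d), integral_const_mul] at this
  simpa [expectedShare, meanAllocation] using this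

variable [Unique ι]

/-- A bids uniformly on `(0, 2 * XA]`; B does the same with probability `XB / XA` and otherwise bids
zero. Both spend exactly their budgets. -/
lemma exists_isEquilibrium_of_unique [Fintype ι] {G : LottoGame ι} (hXB : 0 < G.XB)
    (hX : G.XB ≤ G.XA) (hvA : 0 < G.vA default) (hvB : 0 < G.vB default) :
    ∃ FA FB, G.IsEquilibrium FA FB := by
  have hXA : 0 < G.XA := hXB.trans_le hX
  set T := 2 * G.XA with hTdef
  have hT : 0 < T := by positivity
  set q := G.XB / G.XA with hq
  have h0 : 0 ≤ q := by positivity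
  have h1 : q ≤ 1 := (div_le_one hXA).2 hX
  have hp := isProbabilityMeasure_zeroUniformMix (ι := ι) (T := T) h0 h1
  have hsum : ∀ f : ι → ℝ, ∑ b, f b = f default := fun f => by
    rw [Fintype.sum_unique]
  have hsw := expectedShare_swap (zeroUniformMix ι T q) (uniformAllocation ι T) default
  rw [expectedShare_zeroUniformMix hT h0 h1] at hsw
  refine ⟨uniformAllocation ι T, zeroUniformMix ι T q, ⟨inferInstance, ?_⟩, ⟨hp, ?_⟩,
    fun F hF => ?_, fun F hF => ?_⟩
  · simp only [Fintype.sum_unique]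
    rw [lintegral_uniformAllocation hT.le, hTdef]
    exact ENNReal.ofReal_le_ofReal (by linarith)
  · simp only [Fintype.sum_unique]
    rw [zeroUniformMix, lintegral_add_measure, lintegral_smul_measure, lintegral_smul_measure,
      lintegral_uniformAllocation hT.le, lintegral_dirac]
    simp only [Pi.zero_apply, ENNReal.coe_zero, smul_eq_mul, mul_zero, zero_add]
    rw [← ENNReal.ofReal_mul h0]
    refine ENNReal.ofReal_le_ofReal (le_of_eq ?_)
    rw [hq, hTdef]; field_simp
  · have := hF.1
    rw [lottoPayoff_eq_sum, lottoPayoff_eq_sum, hsum, hsum, hsw]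
    refine mul_le_mul_of_nonneg_left ?_ hvA.le
    have h2 := expectedShare_le_of_winProb_le (hF.integrable default) (c := 1 - q) (d := q / T)
      (F' := zeroUniformMix ι T q) (fun x => by
        have := winProb_zeroUniformMix_le hT h0 h1 (default : ι) x
        rwa [show q / T * (x : ℝ) = q * (x / T) by ring])
    have h3 := hF.sum_meanAllocation_le hXA.le
    rw [hsum] at h3
    have h4 : q / T * meanAllocation F default ≤ q / T * G.XA :=
      mul_le_mul_of_nonneg_left h3 (by positivity)
    have h5 : q / T * G.XA = q / 2 := by rw [hTdef]; field_simp
    linarith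
  · have := hF.1
    rw [lottoPayoff_eq_sum, lottoPayoff_eq_sum, hsum, hsum,
      expectedShare_zeroUniformMix hT h0 h1]
    refine mul_le_mul_of_nonneg_left ?_ hvB.le
    have h2 := expectedShare_le_of_winProb_le (hF.integrable default) (c := 0) (d := 1 / T)
      (F' := uniformAllocation ι T) (fun x => by
        have := winProb_uniformAllocation_le hT (default : ι) x
        rwa [show 0 + 1 / T * (x : ℝ) = x / T by ring])
    have h3 := hF.sum_meanAllocation_le hXB.le
    rw [hsum] at h3
    have h4 : 1 / T * meanAllocation F default ≤ 1 / T * G.XB :=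
      mul_le_mul_of_nonneg_left h3 (by positivity)
    have h5 : 1 / T * G.XB = q / 2 := by rw [hTdef, hq]; field_simp
    linarith

/-- On one battlefield the efforts are the budgets, so eliminating the unknown prizes determines the
payoffs. When `a ≤ b`, the condition `y ≤ x` leaves only `a = b`. -/
lemma IsAllPayOutcome.eq_of_le {a b P x y : ℝ} (h : IsAllPayOutcome a b P x y) (ha : 0 < a)
    (hb : 0 < b) (hyx : y ≤ x) : P = 1 - y / (2 * x) := by
  rcases le_total b a with hab | hab
  · obtain ⟨rfl, rfl, rfl⟩ := h.1 hab
    field_simp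
  · obtain ⟨rfl, rfl, rfl⟩ := h.2 hab
    rw [div_le_div_iff₀ (by norm_num) (by positivity)] at hyx
    have : a = b := by nlinarith
    subst this
    field_simp
    norm_num

/-- The equilibrium payoffs of a Lotto game on a single battlefield, when A is the stronger
player. -/
theorem LottoGame.equilibriumPayoffs_of_unique [Fintype ι] {G : LottoGame ι} (hXB : 0 < G.XB)
    (hX : G.XB ≤ G.XA) (hvA : 0 < G.vA default) (hvB : 0 < G.vB default) :
    G.equilibriumPayoffs =
      {(G.vA default * (1 - G.XB / (2 * G.XA)), G.vB default * (G.XB / (2 * G.XA)))} := by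
  refine Set.eq_singleton_iff_nonempty_unique_mem.2 ⟨?_, ?_⟩
  · obtain ⟨FA, FB, h⟩ := exists_isEquilibrium_of_unique hXB hX hvA hvB
    exact ⟨_, FA, FB, h, rfl⟩
  · rintro u ⟨FA, FB, h, rfl⟩
    obtain ⟨k, m, P, x, y, hk, hm, hP, hx, hy, hA, hB⟩ :=
      h.exists_allPay (hXB.trans_le hX) hXB (fun b => by rwa [Subsingleton.elim b default])
        (fun b => by rwa [Subsingleton.elim b default])
    simp only [Fintype.sum_unique] at hx hy hA hB
    have := (hP default).eq_of_le (mul_pos hk hvA) (mul_pos hm hvB) (by rw [hx, hy]; exact hX)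
    rw [hx, hy] at this
    rw [hA, hB, this]
    simp

end SingleBattlefield

/-! ### Monotonicity of the budget ratio in the multiplier ratio -/

section Branch

/-- The relation between the budget ratio `r`, the ratio `σ` of the multipliers of A and B, and the
payoff `π` of B, in equilibria of `GGL` with `β = α / (1 - α)`. The three cases are: A is stronger
on both battlefields, each player is stronger on the battlefield it values more, B is stronger on
both battlefields. -/
def GGLBranch (β r σ π : ℝ) : Prop :=
  (σ ≤ β ∧ r * β = σ * (1 - β + β ^ 2) ∧ 2 * π * β = σ * (1 - β + β ^ 2)) ∨
  (β ≤ σ ∧ β * σ ≤ 1 ∧ r * (σ ^ 2 + β) = σ * (1 + β * σ ^ 2) ∧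
    2 * π * (1 + β) * σ = 2 * σ - β + β ^ 2 * σ ^ 2) ∨
  (1 ≤ β * σ ∧ r * (1 - β + β ^ 2) = σ * β ∧ 2 * π * σ = 2 * σ - 1)

lemma middle_ratio_lt {β s t : ℝ} (hβ : 0 < β) (hs : 0 < s) (hst : s < t)
    (h : 1 / 2 ≤ β ∨ 1 ≤ β * s ^ 2) :
    s * (1 + β * s ^ 2) / (s ^ 2 + β) < t * (1 + β * t ^ 2) / (t ^ 2 + β) := by
  have ht : 0 < t := hs.trans hst
  rw [div_lt_div_iff₀ (by positivity) (by positivity)]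
  have hz : 0 < s * t := mul_pos hs ht
  -- This is the cofactor of `t - s` in the cross-multiplied difference; only the term `- s * t` is
  -- negative.
  have hpos : 0 < β + β * (s * t) ^ 2 - s * t + β ^ 2 * (s ^ 2 + s * t + t ^ 2) := by
    have h1 : 3 * β ^ 2 * (s * t) ≤ β ^ 2 * (s ^ 2 + s * t + t ^ 2) := by
      nlinarith [mul_nonneg (sq_nonneg β) (sq_nonneg (s - t))]
    have h2 : 0 < β ^ 2 * (s * t) := by positivity
    rcases h with h | h
    · nlinarith [mul_nonneg hβ.le (sq_nonneg (s * t - 1)), mul_nonneg hz.le (sub_nonneg.2 h)]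
    · have : 1 ≤ β * (s * t) := h.trans (by nlinarith [mul_pos hβ hs])
      nlinarith
  nlinarith [mul_pos (sub_pos.2 hst) hpos]

lemma GGLBranch.ratio_lt {β r r' σ τ π ρ : ℝ} (hβ : 0 < β) (hβ1 : β ≤ 1) (hσ : 0 < σ)
    (hστ : σ < τ) (h : 1 / 2 ≤ β ∨ 1 ≤ β * σ ^ 2) (h1 : GGLBranch β r σ π)
    (h2 : GGLBranch β r' τ ρ) : r < r' := by
  have hq : 0 < 1 - β + β ^ 2 := by nlinarith
  have hτ : 0 < τ := hσ.trans hστ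
  have key : ∀ s t, 0 < s → s ≤ t → (1 / 2 ≤ β ∨ 1 ≤ β * s ^ 2) →
      s * (1 + β * s ^ 2) / (s ^ 2 + β) ≤ t * (1 + β * t ^ 2) / (t ^ 2 + β) := by
    intro s t hs hst hh
    rcases hst.eq_or_lt with rfl | hlt
    · exact le_rfl
    · exact (middle_ratio_lt hβ hs hlt hh).le
  -- The three pieces of the budget ratio agree at the junctions `σ = β` and `σ = 1 / β`, so
  -- monotonicity on the pieces glues together.
  have elow : β * (1 + β * β ^ 2) / (β ^ 2 + β) = 1 - β + β ^ 2 := by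
    field_simp; ring
  have ehigh : 1 / β * (1 + β * (1 / β) ^ 2) / ((1 / β) ^ 2 + β) = 1 / (1 - β + β ^ 2) := by
    rw [div_eq_div_iff (by positivity) hq.ne']
    field_simp; ring
  rcases h1 with ⟨a1, a2, -⟩ | ⟨a1, a2, a3, -⟩ | ⟨a1, a2, -⟩ <;>
  rcases h2 with ⟨b1, b2, -⟩ | ⟨b1, b2, b3, -⟩ | ⟨b1, b2, -⟩
  · have := mul_lt_mul_of_pos_right hστ hq
    nlinarith
  · have hβ' : 1 / 2 ≤ β ∨ 1 ≤ β * β ^ 2 :=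
      h.imp_right fun h => h.trans (by gcongr)
    have hr : r = σ / β * (1 - β + β ^ 2) := by field_simp; linarith
    have hr' : r' = τ * (1 + β * τ ^ 2) / (τ ^ 2 + β) := by field_simp; linarith
    rcases b1.eq_or_lt with rfl | b1
    · rw [hr', elow, hr]
      have : σ / β < 1 := (div_lt_one hβ).2 hστ
      nlinarith
    · have hlt := middle_ratio_lt hβ hβ b1 hβ'
      rw [elow] at hlt
      rw [hr', hr]
      have : σ / β ≤ 1 := (div_le_one hβ).2 a1
      nlinarith
  · have hr : r ≤ 1 - β + β ^ 2 := by nlinarith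
    have hr' : 1 / (1 - β + β ^ 2) ≤ r' := by
      rw [div_le_iff₀ hq]; linarith
    have h3 : 1 - β + β ^ 2 ≤ 1 := by nlinarith
    have h4 : 1 ≤ 1 / (1 - β + β ^ 2) := by rw [le_div_iff₀ hq]; linarith
    rcases hβ1.eq_or_lt with rfl | hβ1
    · norm_num at a2 b2; linarith
    · have : 1 - β + β ^ 2 < 1 := by nlinarith
      linarith
  · linarith
  · have hr : r = σ * (1 + β * σ ^ 2) / (σ ^ 2 + β) := by field_simp; linarith
    have hr' : r' = τ * (1 + β * τ ^ 2) / (τ ^ 2 + β) := by field_simp; linarith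
    rw [hr, hr']
    exact middle_ratio_lt hβ hσ hστ h
  · have hr : r = σ * (1 + β * σ ^ 2) / (σ ^ 2 + β) := by field_simp; linarith
    have hr' : r' = (β * τ) * (1 / (1 - β + β ^ 2)) := by
      field_simp; linarith
    have hi : 0 < 1 / (1 - β + β ^ 2) := by positivity
    rcases a2.eq_or_lt with a2 | a2
    · have hs : σ = 1 / β := by field_simp; linarith
      rw [hr, hr', hs, ehigh]
      have : 1 < β * τ := a2 ▸ mul_lt_mul_of_pos_left hστ hβ
      nlinarith
    · have hlt := middle_ratio_lt hβ hσ (t := 1 / β) (by rw [lt_div_iff₀ hβ]; linarith) h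
      rw [ehigh] at hlt
      rw [hr, hr']
      nlinarith
  · nlinarith
  · nlinarith
  · have := mul_lt_mul_of_pos_right hστ hβ
    nlinarith

lemma GGLBranch.payoff_unique {β r σ π ρ : ℝ} (hβ : 0 < β) (hβ1 : β ≤ 1) (hσ : 0 < σ)
    (h1 : GGLBranch β r σ π) (h2 : GGLBranch β r σ ρ) : π = ρ := by
  have hboth : σ ≤ β → 1 ≤ β * σ → β = 1 ∧ σ = 1 := fun h3 h4 => by
    have : β = 1 := by nlinarith
    subst this
    exact ⟨rfl, by linarith⟩
  rcases h1 with ⟨a1, a2, a3⟩ | ⟨a1, a2, a3, a4⟩ | ⟨a1, a2, a3⟩ <;>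
  rcases h2 with ⟨b1, b2, b3⟩ | ⟨b1, b2, b3, b4⟩ | ⟨b1, b2, b3⟩
  · exact mul_right_cancel₀ hβ.ne' (by linarith)
  · have : σ = β := le_antisymm a1 b1
    subst this
    have : 0 < σ * (1 + σ) := by positivity
    exact mul_right_cancel₀ this.ne' (by nlinarith)
  · obtain ⟨rfl, rfl⟩ := hboth a1 b1
    linarith
  · have : σ = β := le_antisymm b1 a1
    subst this
    have : 0 < σ * (1 + σ) := by positivity
    exact mul_right_cancel₀ this.ne' (by nlinarith)
  · have : 0 < σ * (1 + β) := by positivity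
    exact mul_right_cancel₀ this.ne' (by nlinarith)
  · have hc : β * σ = 1 := le_antisymm a2 b1
    have : 0 < σ * (1 + β) := by positivity
    refine mul_right_cancel₀ this.ne' ?_
    have : β ^ 2 * σ ^ 2 = 1 := by rw [← mul_pow, hc]; norm_num
    nlinarith
  · obtain ⟨rfl, rfl⟩ := hboth b1 a1
    linarith
  · have hc : β * σ = 1 := le_antisymm b2 a1
    have : 0 < σ * (1 + β) := by positivity
    refine mul_right_cancel₀ this.ne' ?_
    have : β ^ 2 * σ ^ 2 = 1 := by rw [← mul_pow, hc]; norm_num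
    nlinarith
  · exact mul_right_cancel₀ hσ.ne' (by linarith)

lemma GGLBranch.payoff_eq {β r σ τ π ρ : ℝ} (hβ : 0 < β) (hβ1 : β ≤ 1) (hσ : 0 < σ) (hτ : 0 < τ)
    (hs : 1 / 2 ≤ β ∨ 1 ≤ β * σ ^ 2) (ht : 1 / 2 ≤ β ∨ 1 ≤ β * τ ^ 2)
    (h1 : GGLBranch β r σ π) (h2 : GGLBranch β r τ ρ) : π = ρ := by
  rcases lt_trichotomy σ τ with h | rfl | h
  · exact absurd (h1.ratio_lt hβ hβ1 hσ h hs h2) (lt_irrefl _)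
  · exact h1.payoff_unique hβ hβ1 hσ h2
  · exact absurd (h2.ratio_lt hβ hβ1 hτ h ht h1) (lt_irrefl _)

/-- Since `1 - α = 1 / (1 + β)`, the hypothesis on `π` says that B gets at least `1 - α`. This
excludes the first case; in the second, the payoff formula turns it into the conclusion; in the
third, `β * σ ≥ 1` and `σ ≥ 1` suffice. -/
lemma GGLBranch.one_le_mul_sq {β r σ π : ℝ} (hβ : 0 < β) (hβ1 : β < 1) (hσ : 0 < σ)
    (h : GGLBranch β r σ π) (hπ : 1 ≤ π * (1 + β)) : 1 ≤ β * σ ^ 2 := by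
  rcases h with ⟨a1, -, a3⟩ | ⟨-, -, -, a4⟩ | ⟨a1, -, -⟩
  · exfalso
    have hq : 0 < 1 - β + β ^ 2 := by nlinarith
    have h1 : 2 * π ≤ 1 - β + β ^ 2 := by nlinarith
    have h2 : 2 * π * (1 + β) ≤ 1 + β ^ 3 := by nlinarith
    have h3 : β ^ 3 < 1 := pow_lt_one₀ hβ.le hβ1 (by norm_num)
    linarith
  · have h1 : 2 * σ ≤ 2 * π * (1 + β) * σ := by nlinarith
    have h2 : β ≤ β * (β * σ ^ 2) := by nlinarith
    exact le_of_mul_le_mul_left (by linarith) hβ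
  · have : 1 ≤ σ := by nlinarith
    nlinarith

end Branch

/-! ### Reduction of equilibria of `GGL` to branches -/

section GGL

/-- Which player has the larger scaled prize depends only on `σ = m / k`, compared with `β` on
battlefield 1 and with `1 / β` on battlefield 2. Dividing the two budget equations removes the
remaining scale `k`. -/
lemma exists_branch_of_mem_equilibriumPayoffsB {XA XB α : ℝ} (hXA : 0 < XA) (hXB : 0 < XB)
    (hα0 : 0 < α) (hα : α ≤ 1 / 2) {π : ℝ} (hπ : π ∈ (GGL XA XB α).equilibriumPayoffsB) :
    ∃ σ, 0 < σ ∧ GGLBranch (α / (1 - α)) (XB / XA) σ π := by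
  obtain ⟨-, ⟨FA, FB, h, rfl⟩, rfl⟩ := hπ
  have hc : 0 < 1 - α := by linarith
  obtain ⟨k, m, P, x, y, hk, hm, hP, hx, hy, -, hB⟩ := h.exists_allPay hXA hXB
    (by simp [GGL, Fin.forall_fin_two, hα0]; linarith)
    (by simp [GGL, Fin.forall_fin_two, hα0]; linarith)
  have hP0 := hP 0
  have hP1 := hP 1
  simp only [GGL, Fin.sum_univ_two, Matrix.cons_val_zero, Matrix.cons_val_one] at *
  rw [hB]
  clear hB hP h
  obtain ⟨β, hβdef⟩ : ∃ β, β = α / (1 - α) := ⟨_, rfl⟩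
  obtain ⟨σ, hσdef⟩ : ∃ σ, σ = m / k := ⟨_, rfl⟩
  have hβ : 0 < β := by rw [hβdef]; positivity
  have hσ : 0 < σ := by rw [hσdef]; positivity
  have hβ1 : β ≤ 1 := by rw [hβdef, div_le_one hc]; linarith
  have hm' : m = σ * k := by rw [hσdef]; field_simp
  have hc' : 1 - α = 1 / (1 + β) := by rw [hβdef]; field_simp; ring
  have hα' : α = β / (1 + β) := by rw [hβdef]; field_simp; ring
  rw [← hβdef]
  rw [hc', hα', hm'] at hP0 hP1
  rw [hc', hα']
  refine ⟨σ, hσ, ?_⟩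
  have hlow : (σ * k * (1 / (1 + β)) ≤ k * (β / (1 + β))) ↔ σ ≤ β := by
    rw [show σ * k * (1 / (1 + β)) = σ * (k / (1 + β)) by ring,
      show k * (β / (1 + β)) = β * (k / (1 + β)) by ring, mul_le_mul_iff_left₀ (by positivity)]
  have hlow' : (k * (β / (1 + β)) ≤ σ * k * (1 / (1 + β))) ↔ β ≤ σ := by
    rw [show σ * k * (1 / (1 + β)) = σ * (k / (1 + β)) by ring,
      show k * (β / (1 + β)) = β * (k / (1 + β)) by ring, mul_le_mul_iff_left₀ (by positivity)]
  have hhigh : (σ * k * (β / (1 + β)) ≤ k * (1 / (1 + β))) ↔ β * σ ≤ 1 := by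
    rw [show σ * k * (β / (1 + β)) = β * σ * (k / (1 + β)) by ring,
      show k * (1 / (1 + β)) = 1 * (k / (1 + β)) by ring, mul_le_mul_iff_left₀ (by positivity)]
  have hhigh' : (k * (1 / (1 + β)) ≤ σ * k * (β / (1 + β))) ↔ 1 ≤ β * σ := by
    rw [show σ * k * (β / (1 + β)) = β * σ * (k / (1 + β)) by ring,
      show k * (1 / (1 + β)) = 1 * (k / (1 + β)) by ring, mul_le_mul_iff_left₀ (by positivity)]
  rw [IsAllPayOutcome, hlow, hlow'] at hP0
  rw [IsAllPayOutcome, hhigh, hhigh'] at hP1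
  rw [← hx, ← hy]
  have hq : 0 < 1 - β + β ^ 2 := by nlinarith
  rcases le_total σ β with h1 | h1
  · left
    obtain ⟨e1, e2, e3⟩ := hP0.1 h1
    obtain ⟨f1, f2, f3⟩ := hP1.1 (by nlinarith)
    rw [e1, e2, e3, f1, f2, f3]
    refine ⟨h1, ?_, ?_⟩
    · field_simp; ring
    · field_simp; ring
  · rcases le_total (β * σ) 1 with h2 | h2
    · right; left
      obtain ⟨e1, e2, e3⟩ := hP0.2 h1
      obtain ⟨f1, f2, f3⟩ := hP1.1 h2
      rw [e1, e2, e3, f1, f2, f3]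
      refine ⟨h1, h2, ?_, ?_⟩
      · field_simp; ring
      · field_simp; ring
    · right; right
      obtain ⟨e1, e2, e3⟩ := hP0.2 h1
      obtain ⟨f1, f2, f3⟩ := hP1.2 h2
      rw [e1, e2, e3, f1, f2, f3]
      refine ⟨h2, ?_, ?_⟩
      · field_simp; ring
      · field_simp; ring

end GGL

/-! ### Pre-commitments that A does not match -/

section Precommitment

instance uniqueNeZero : Unique {c : Fin 2 // c ≠ 0} where
  default := ⟨1, one_ne_zero⟩
  uniq := fun ⟨c, hc⟩ => Subtype.ext (Fin.eq_one_of_ne_zero c hc)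

lemma equilibriumPayoffs_afterWithdraw {XA XB α p : ℝ} (hα0 : 0 < α) (hα1 : α < 1)
    (hp : p < XB) (h : XB - p ≤ XA) :
    ((GGL XA XB α).afterWithdraw 0 p).equilibriumPayoffs =
      {((1 - α) * (1 - (XB - p) / (2 * XA)), α * ((XB - p) / (2 * XA)))} :=
  LottoGame.equilibriumPayoffs_of_unique (sub_pos.2 hp) h (sub_pos.2 hα1) hα0

lemma equilibriumPayoffs_afterMatch {XA XB α p : ℝ} (hα0 : 0 < α) (hα1 : α < 1)
    (hp : p < XB) (h : XB ≤ XA) :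
    ((GGL XA XB α).afterMatch 0 p).equilibriumPayoffs =
      {((1 - α) * (1 - (XB - p) / (2 * (XA - p))), α * ((XB - p) / (2 * (XA - p))))} :=
  LottoGame.equilibriumPayoffs_of_unique (sub_pos.2 hp) (sub_le_sub_right h p) (sub_pos.2 hα1) hα0

/-- A pre-commitment below the budget of B that A cannot profitably match. -/
lemma precommit_withdraw {XA XB α p : ℝ} (hXA : 0 < XA) (hα0 : 0 < α) (hα1 : α < 1)
    (hp : p < XB) (h : XB - p ≤ XA)
    (hmatch : p ≤ XA → XB ≤ XA ∧
      α + (1 - α) * (1 - (XB - p) / (2 * (XA - p))) ≤ (1 - α) * (1 - (XB - p) / (2 * XA))) :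
    (∃ uA uB, (GGL XA XB α).IsPrecommitOutcome 0 p .withdraw uA uB) ∧
      ∀ r uA uB, (GGL XA XB α).IsPrecommitOutcome 0 p r uA uB →
        r = .withdraw ∧ 1 - α < uB := by
  have hw := equilibriumPayoffs_afterWithdraw hα0 hα1 hp h
  have hm := fun hX => equilibriumPayoffs_afterMatch (XA := XA) hα0 hα1 hp hX
  constructor
  · refine ⟨_, _, _, hw ▸ Set.mem_singleton _, fun hpA => ?_, rfl, rfl⟩
    obtain ⟨hX, hle⟩ := hmatch hpA
    rw [hm hX]
    exact ⟨_, rfl, hle⟩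
  · rintro (_ | _) uA uB hr
    · obtain ⟨hpA, m, hmm, w, hww, hlt, -, -⟩ := hr
      obtain ⟨hX, hle⟩ := hmatch hpA
      rw [hm hX, Set.mem_singleton_iff] at hmm
      rw [hw, Set.mem_singleton_iff] at hww
      rw [hmm, hww] at hlt
      exact absurd hle (not_le.2 hlt)
    · obtain ⟨w, hww, -, -, rfl⟩ := hr
      rw [hw, Set.mem_singleton_iff] at hww
      refine ⟨rfl, ?_⟩
      rw [hww]
      have : 0 < α * ((XB - p) / (2 * XA)) :=
        mul_pos hα0 (div_pos (sub_pos.2 hp) (by positivity))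
      change 1 - α < (1 - α) + α * ((XB - p) / (2 * XA))
      linarith

lemma exists_precommit_of_lt {XA XB α : ℝ} (hXA : 0 < XA) (hα0 : 0 < α) (hα1 : α < 1)
    (h : XA < XB) :
    ∃ p : ℝ, 0 ≤ p ∧ p ≤ XB ∧
      (∃ uA uB, (GGL XA XB α).IsPrecommitOutcome 0 p .withdraw uA uB) ∧
      ∀ r uA uB, (GGL XA XB α).IsPrecommitOutcome 0 p r uA uB →
        r = .withdraw ∧ 1 - α < uB := by
  -- The midpoint exceeds `XA`, so A cannot match; `XB - XA` keeps A the stronger player on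
  -- battlefield 2. Both are below `XB`.
  set p := max ((XA + XB) / 2) (XB - XA) with hp
  have h1 : (XA + XB) / 2 ≤ p := le_max_left _ _
  have h2 : XB - XA ≤ p := le_max_right _ _
  have h3 : p < XB := max_lt (by linarith) (by linarith)
  exact ⟨p, by linarith, h3.le,
    precommit_withdraw hXA hα0 hα1 h3 (by linarith) fun h4 => by linarith⟩

lemma exists_precommit_of_le {XA XB α : ℝ} (hXA : 0 < XA) (hα0 : 0 < α) (hα1 : α < 1)
    (hβ : α / (1 - α) < 1 / 2) (hlow : √(8 * α / (1 - α)) - 2 * α / (1 - α) ≤ XB / XA)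
    (h : XB / XA ≤ 1) :
    ∃ p : ℝ, 0 ≤ p ∧ p ≤ XB ∧
      (∃ uA uB, (GGL XA XB α).IsPrecommitOutcome 0 p .withdraw uA uB) ∧
      ∀ r uA uB, (GGL XA XB α).IsPrecommitOutcome 0 p r uA uB →
        r = .withdraw ∧ 1 - α < uB := by
  have hc : 0 < 1 - α := by linarith
  rw [mul_div_assoc, mul_div_assoc] at hlow
  obtain ⟨β, hβdef⟩ : ∃ β, β = α / (1 - α) := ⟨_, rfl⟩
  obtain ⟨r, hr⟩ : ∃ r, r = XB / XA := ⟨_, rfl⟩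
  have hαβ : α = β * (1 - α) := by rw [hβdef]; field_simp
  have hXB : XB = r * XA := by rw [hr]; field_simp
  rw [← hβdef] at hβ hlow
  rw [← hr] at hlow h
  have hβ0 : 0 < β := by rw [hβdef]; positivity
  have hsq : √(8 * β) ≤ r + 2 * β := by linarith
  have hs0 : 0 ≤ r + 2 * β := (Real.sqrt_nonneg _).trans hsq
  have hdisc : 8 * β ≤ (r + 2 * β) ^ 2 := (Real.sqrt_le_left hs0).1 hsq
  -- From `β < 1/2`, `(r + 2 * β) ^ 2 ≥ 8 * β > (4 * β) ^ 2`.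
  have hβr : 2 * β < r := by nlinarith
  -- Withdrawing is optimal against `t * XA` when `t ^ 2 - (r + 2 * β) * t + 2 * β ≤ 0`. This `t` is
  -- the vertex, where the inequality reads `8 * β ≤ (r + 2 * β) ^ 2`.
  obtain ⟨t, ht⟩ : ∃ t, t = (r + 2 * β) / 2 := ⟨_, rfl⟩
  have ht0 : 0 < t := by linarith
  have htr : t < r := by linarith
  have ht1 : t < 1 := by linarith
  have hquad : 2 * β * (1 - t) ≤ (r - t) * t := by rw [ht]; nlinarith
  refine ⟨t * XA, by positivity, by rw [hXB]; gcongr, precommit_withdraw hXA hα0 hα1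
    (by rw [hXB]; gcongr) (by rw [hXB]; nlinarith) fun _ => ⟨by rw [hXB]; nlinarith, ?_⟩⟩
  have e1 : (XB - t * XA) / (2 * (XA - t * XA)) = (r - t) / (2 * (1 - t)) := by
    rw [hXB, show r * XA - t * XA = (r - t) * XA by ring,
      show 2 * (XA - t * XA) = 2 * (1 - t) * XA by ring, mul_div_mul_right _ _ hXA.ne']
  have e2 : (XB - t * XA) / (2 * XA) = (r - t) / 2 := by
    rw [hXB, show r * XA - t * XA = (r - t) * XA by ring, mul_div_mul_right _ _ hXA.ne']
  have e3 : β + (r - t) / 2 ≤ (r - t) / (2 * (1 - t)) := by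
    rw [le_div_iff₀ (by linarith)]; nlinarith
  rw [e1, e2]
  nlinarith [mul_le_mul_of_nonneg_left e3 hc.le]

end Precommitment

theorem theorem2 (XA XB α : ℝ) (hXA : 0 < XA) (hXB : 0 < XB) (hα0 : 0 < α) (hα : α ≤ 1 / 2)
    (π₁ π₂ π₃ : ℝ)
    (hthree : (GGL XA XB α).equilibriumPayoffsB = {π₁, π₂, π₃})
    (h₁₂ : π₂ < π₁) (h₂₃ : π₃ < π₂)
    (hratio : (√(8 * α / (1 - α)) - 2 * α / (1 - α) ≤ XB / XA ∧ XB / XA ≤ 1) ∨ 1 < XB / XA) :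
    π₂ < 1 - α ∧
    ∃ p : ℝ, 0 ≤ p ∧ p ≤ XB ∧
      (∃ uA uB, (GGL XA XB α).IsPrecommitOutcome 0 p .withdraw uA uB) ∧
      ∀ r uA uB, (GGL XA XB α).IsPrecommitOutcome 0 p r uA uB →
        r = .withdraw ∧ 1 - α < uB := by
  have hc : 0 < 1 - α := by linarith
  have hα1 : α < 1 := by linarith
  obtain ⟨σ, hσ, hb1⟩ := exists_branch_of_mem_equilibriumPayoffsB hXA hXB hα0 hα
    (π := π₁) (by rw [hthree]; simp)
  obtain ⟨τ, hτ, hb2⟩ := exists_branch_of_mem_equilibriumPayoffsB hXA hXB hα0 hα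
    (π := π₂) (by rw [hthree]; simp)
  have hβ0 : 0 < α / (1 - α) := by positivity
  have hβ1 : α / (1 - α) ≤ 1 := by rw [div_le_one hc]; linarith
  have hβ : α / (1 - α) < 1 / 2 := by
    by_contra hge
    -- For `1/2 ≤ β` the budget ratio determines `σ`, hence the payoff, so `π₁` and `π₂` would
    -- coincide.
    exact h₁₂.ne' (hb1.payoff_eq hβ0 hβ1 hσ hτ (.inl (not_lt.1 hge)) (.inl (not_lt.1 hge)) hb2)
  refine ⟨?_, ?_⟩
  · by_contra hge
    have hlarge : ∀ π, 1 - α ≤ π → 1 ≤ π * (1 + α / (1 - α)) := fun π hπ => by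
      rw [show 1 + α / (1 - α) = 1 / (1 - α) by field_simp; ring, mul_one_div, le_div_iff₀ hc]
      linarith
    have h2 := not_lt.1 hge
    exact h₁₂.ne' (hb1.payoff_eq hβ0 hβ1 hσ hτ
      (.inr (hb1.one_le_mul_sq hβ0 (by linarith) hσ (hlarge _ (h2.trans h₁₂.le))))
      (.inr (hb2.one_le_mul_sq hβ0 (by linarith) hτ (hlarge _ h2))) hb2)
  · rcases hratio with ⟨hlow, hle⟩ | hgt
    · exact exists_precommit_of_le hXA hα0 hα1 hβ hlow hle
    · exact exists_precommit_of_lt hXA hα0 hα1 ((one_lt_div hXA).1 hgt)
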